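/- Let $\mathcal G_1,\mathcal G_2\subset\mathbb N=\{0,1,2,\dots\}$ be sets (finite or infinite) of pairwise coprime numbers and let $\mathcal H_1,\mathcal H_2$ be finite sets of integers. For an integer $g\ge 1$ let $\nu_g(\mathcal H_i)$ be the number of distinct residue classes modulo $g$ occupied by the elements of $\mathcal H_i$, and suppose that $\mathcal H_i$ is admissible with respect to $\mathcal G_i$, that is, $g\ge 1$ and $\nu_g(\mathcal H_i)<g$ for every $g\in\mathcal G_i$ ($i=1,2$). Put $$\mathcal V_i=\{n\in\mathbb N:\ n\not\equiv h \pmod g\ \text{ for all } h\in\mathcal H_i,\ g\in\mathcal G_i\},\qquad \mathcal V^2=\mathcal V_1\times\mathcal V_2\subset\mathbb N^2 .$$ Let $\mathcal A^i$ be the set of all finite products of distinct elements of $\mathcal G_i$ (including the empty product $1$), and for a constant $A_i>0$ and $x>0$ let $\mathcal A^i_x=\{a\in\mathcal A^i: a\le x^{A_i}\}$. Suppose that, for $i=1,2$, the sets $\mathcal A^i_x$ meet the following Condition A with some $\theta_i\in(0,1)$: there is a constant $\varepsilon_i$ with $0<\varepsilon_i<A_i$ such that, with implied constants independent of $x$,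 $a$ and $y$, for all sufficiently large $x$, $$a\ll x^{A_i}\ \text{ for all } a\in\mathcal A^i_x,\qquad\text{and}\qquad |\mathcal A^i_x\cap[1,y]|\ll \frac{y^{\theta_i}}{(\log y)^{A_i}}\ \text{ for all } y\ge x^{\varepsilon_i}.$$ Let $\alpha\in(0,1)$ and let $(P_j)_{j\ge0}$ be an $\alpha$-random walk on $\mathbb N^2$: $P_0=(0,0)$, and the steps $P_{j+1}-P_j$ are independent, equal to $(1,0)$ with probability $\alpha$ and to $(0,1)$ with probability $1-\alpha$. Then the products $$c_i=\prod_{g\in\mathcal G_i}\Bigl(1-\frac{\nu_g(\mathcal H_i)}{g}\Bigr)\qquad(i=1,2)$$ converge unconditionally, and almost surely $$\lim_{n\to\infty}\frac{\#\{1\le j\le n:\ P_j\in\mathcal V^2\}}{n}=c_1c_2 .$$ -/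

import Mathlib

open MeasureTheory ProbabilityTheory Filter Topology

/-- The set of natural numbers sieved by `G` with respect to `H`: those `n` with
`n ≢ h (mod g)` for every `h ∈ H` and every `g ∈ G`. -/
def sievedSet (G : Set ℕ) (H : Finset ℤ) : Set ℕ :=
  {n | ∀ h ∈ H, ∀ g ∈ G, ¬ (n : ℤ) ≡ h [ZMOD (g : ℤ)]}

/-- The number `ν_g(H)` of distinct residue classes modulo `g` occupied by the elements of `H`. -/
def residueCount (H : Finset ℤ) (g : ℕ) : ℕ :=
  (H.image (fun h : ℤ => h % (g : ℤ))).card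

/-- `H` is admissible with respect to `G`: for every `g ∈ G` the elements of `H` do not occupy
all residue classes modulo `g`. (In particular this excludes `0 ∈ G`.) -/
def Admissible (G : Set ℕ) (H : Finset ℤ) : Prop :=
  ∀ g ∈ G, residueCount H g < g

/-- The local factor `1 - ν_g(H) / g`, for `g ∈ G`. -/
noncomputable def localFactor (G : Set ℕ) (H : Finset ℤ) (g : G) : ℝ :=
  1 - (residueCount H (g : ℕ) : ℝ) / ((g : ℕ) : ℝ)

/-- The constant `∏_{g ∈ G} (1 - ν_g(H) / g)`. -/
noncomputable def sieveDensity (G : Set ℕ) (H : Finset ℤ) : ℝ :=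
  ∏' g : G, localFactor G H g

/-- The set `𝒜` of all products of distinct elements of `G`; the empty product gives `1 ∈ 𝒜`. -/
def productSet (G : Set ℕ) : Set ℕ :=
  {a | ∃ s : Finset ℕ, (s : Set ℕ) ⊆ G ∧ a = ∏ g ∈ s, g}

/-- The truncated product set `𝒜_x = {a ∈ 𝒜 : a ≤ x ^ A}`. -/
def truncProductSet (G : Set ℕ) (A : ℝ) (x : ℝ) : Set ℕ :=
  {a | a ∈ productSet G ∧ (a : ℝ) ≤ x ^ A}

/-- Condition A with exponent `θ` for a family `𝒜 x` of sets of positive integers, relative to the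
constants `A` and `ε`: for all large `x`, uniformly, `a ≪ x ^ A` for `a ∈ 𝒜 x`, and
`|𝒜 x ∩ [1, y]| ≪ y ^ θ / (log y) ^ A` for all `y ≥ x ^ ε`. The implied constants do not depend
on `x`, `a`, `y`. -/
structure ConditionA (θ A ε : ℝ) (𝒜 : ℝ → Set ℕ) : Prop where
  theta_pos : 0 < θ
  theta_le_one : θ ≤ 1
  pos : ∀ᶠ x : ℝ in atTop, ∀ a ∈ 𝒜 x, 0 < a
  le_pow : ∃ C : ℝ, ∀ᶠ x : ℝ in atTop, ∀ a ∈ 𝒜 x, (a : ℝ) ≤ C * x ^ A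
  card_le : ∃ C : ℝ, ∀ᶠ x : ℝ in atTop, ∀ y : ℝ, x ^ ε ≤ y →
    (({a | a ∈ 𝒜 x ∧ 1 ≤ a ∧ (a : ℝ) ≤ y} : Set ℕ).ncard : ℝ) ≤ C * (y ^ θ / (Real.log y) ^ A)

/-- `P` is an `α`-random walk on `ℕ × ℕ`: it starts at `(0, 0)`, and its steps `W 0, W 1, …` are
independent, equal to `(1, 0)` with probability `α` and to `(0, 1)` with probability `1 - α`. -/
structure IsAlphaRandomWalk {Ω : Type*} [MeasurableSpace Ω] (μ : Measure Ω) (α : ℝ)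
    (P : ℕ → Ω → ℕ × ℕ) : Prop where
  start : ∀ ω, P 0 ω = (0, 0)
  steps : ∃ W : ℕ → Ω → ℕ × ℕ, (∀ i, Measurable (W i)) ∧ iIndepFun W μ ∧
    (∀ i, μ {ω | W i ω = (1, 0)} = ENNReal.ofReal α) ∧
    (∀ i, μ {ω | W i ω = (0, 1)} = ENNReal.ofReal (1 - α)) ∧
    ∀ i ω, P (i + 1) ω = P i ω + W i ω

/-- The proportion of the times `1, …, n` at which the trajectory `p` lies in `V`. -/
noncomputable def visitProportion (V : Set (ℕ × ℕ)) (p : ℕ → ℕ × ℕ) (n : ℕ) : ℝ :=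
  (∑ i ∈ Finset.Icc 1 n, V.indicator (fun _ => (1 : ℝ)) (p i)) / n

/-! Let `ξ j` indicate that the `j`-th step is `(1, 0)`. For bounded `f` the variables `f (P j) * (ξ
j - α)` are bounded and pairwise orthogonal, since each step is independent of the past, so their
averages tend to `0` almost surely (`ae_tendsto_avg_of_orthogonal`,
`IsAlphaRandomWalk.exists_steps`). Everything else is deterministic, for a path on which this holds
for countably many `f`.

Moduli up to `z`: membership depends only on the image of the walk in a finite group, a product of
rings `ZMod g`, whose elements are all reached by lattice points. Solving the Poisson equation there
(`exists_walkLaplacian_eq`) writes a function minus its mean as a telescoping term plus a balanced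
term, so time averages tend to the mean. By the Chinese remainder theorem that mean is the product
of the two finite sieve products.

Moduli beyond `z`: Condition A, applied to one-element products, gives `|G ∩ [1, n]| ≪ n ^ θ` with
`θ < 1`, so the reciprocals of `G` are summable; this also yields the infinite products. Balance for
the indicator of the removed integers in one coordinate reduces the visits up to time `n` to
counting removed integers below `n`, which is at most `n` times a small tail, up to a bounded error.
Finally `n → ∞`, then `z → ∞`. -/

/-! ### A strong law for bounded orthogonal variables -/

theorem abs_sum_range_sub_le {d : ℕ → ℝ} {C : ℝ} (hd : ∀ j, |d j| ≤ C) {m n : ℕ} (hmn : m ≤ n) :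
    |∑ j ∈ Finset.range n, d j - ∑ j ∈ Finset.range m, d j| ≤ C * (n - m : ℕ) := by
  rw [← Finset.sum_Ico_eq_sub _ hmn]
  calc |∑ j ∈ Finset.Ico m n, d j| ≤ ∑ j ∈ Finset.Ico m n, |d j| := Finset.abs_sum_le_sum_abs _ _
    _ ≤ ∑ j ∈ Finset.Ico m n, C := Finset.sum_le_sum fun j _ => hd j
    _ = C * (n - m : ℕ) := by simp [mul_comm]

theorem tendsto_sum_div_of_tendsto_squares {d : ℕ → ℝ} {C : ℝ} (hd : ∀ j, |d j| ≤ C)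
    (h : Tendsto (fun k : ℕ => (∑ j ∈ Finset.range (k ^ 2), d j) / (k : ℝ) ^ 2) atTop (𝓝 0)) :
    Tendsto (fun n : ℕ => (∑ j ∈ Finset.range n, d j) / (n : ℝ)) atTop (𝓝 0) := by
  have hC : 0 ≤ C := (abs_nonneg _).trans (hd 0)
  have hsqrt : Tendsto Nat.sqrt atTop atTop := by
    refine tendsto_atTop.2 fun b => ?_
    filter_upwards [eventually_ge_atTop (b ^ 2)] with n hn
    rw [Nat.le_sqrt]; nlinarith
  have hmaj : Tendsto (fun k : ℕ => |(∑ j ∈ Finset.range (k ^ 2), d j) / (k : ℝ) ^ 2|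
      + 2 * C * (k : ℝ)⁻¹) atTop (𝓝 0) := by
    have := h.abs.add ((tendsto_inv_atTop_nhds_zero_nat (𝕜 := ℝ)).const_mul (2 * C))
    simpa using this
  refine squeeze_zero_norm' ?_ (hmaj.comp hsqrt)
  filter_upwards [eventually_ge_atTop 1] with n hn
  have hk : 0 < Nat.sqrt n := Nat.sqrt_pos.2 hn
  simp only [Function.comp, Real.norm_eq_abs]
  set k := Nat.sqrt n
  have hkn : k ^ 2 ≤ n := Nat.sqrt_le' n
  -- Passing from `k ^ 2` to `n` costs at most `2 * C * k`, negligible against `k ^ 2`.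
  have hkn' : n - k ^ 2 ≤ 2 * k := by
    have : n ≤ k * k + k + k := Nat.sqrt_le_add n
    have h2 : k ^ 2 = k * k := sq k
    omega
  have hkR : (0 : ℝ) < k := by exact_mod_cast hk
  have hkn'' : ((k : ℝ)) ^ 2 ≤ n := by exact_mod_cast hkn
  have h1 := abs_sum_range_sub_le hd hkn
  have h2 : C * ((n - k ^ 2 : ℕ) : ℝ) ≤ C * (2 * k) := by
    gcongr; exact_mod_cast hkn'
  rw [abs_div, abs_div, abs_of_nonneg (by positivity : (0 : ℝ) ≤ n),
    abs_of_nonneg (by positivity : (0 : ℝ) ≤ (k : ℝ) ^ 2)]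
  have h3 := abs_sub_abs_le_abs_sub (∑ j ∈ Finset.range n, d j) (∑ j ∈ Finset.range (k ^ 2), d j)
  calc |∑ j ∈ Finset.range n, d j| / (n : ℝ)
      ≤ (|∑ j ∈ Finset.range (k ^ 2), d j| + C * (2 * k)) / (n : ℝ) := by gcongr; linarith
    _ ≤ (|∑ j ∈ Finset.range (k ^ 2), d j| + C * (2 * k)) / (k : ℝ) ^ 2 := by gcongr
    _ = _ := by field_simp

/-- The strong law of large numbers for bounded, pairwise orthogonal random variables. -/
theorem ae_tendsto_avg_of_orthogonal {Ω : Type*} [MeasurableSpace Ω] {μ : Measure Ω}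
    [IsProbabilityMeasure μ] {D : ℕ → Ω → ℝ} {C : ℝ} (hmeas : ∀ j, Measurable (D j))
    (hD : ∀ j ω, |D j ω| ≤ C) (horth : ∀ i j, i < j → ∫ ω, D i ω * D j ω ∂μ = 0) :
    ∀ᵐ ω ∂μ, Tendsto (fun n : ℕ => (∑ j ∈ Finset.range n, D j ω) / (n : ℝ)) atTop (𝓝 0) := by
  have hint : ∀ i j, Integrable (fun ω => D i ω * D j ω) μ := fun i j => by
    refine Integrable.of_bound ((hmeas i).mul (hmeas j)).aestronglyMeasurable (C * C)
      (ae_of_all _ fun ω => ?_)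
    rw [Real.norm_eq_abs, abs_mul]
    exact mul_le_mul (hD i ω) (hD j ω) (abs_nonneg _) ((abs_nonneg _).trans (hD i ω))
  have hsq : ∀ n, ∫ ω, (∑ j ∈ Finset.range n, D j ω) ^ 2 ∂μ ≤ C ^ 2 * n := fun n => by
    have : ∀ ω, (∑ j ∈ Finset.range n, D j ω) ^ 2
        = ∑ i ∈ Finset.range n, ∑ j ∈ Finset.range n, D i ω * D j ω := fun ω => by
      rw [sq, Finset.sum_mul_sum]
    simp_rw [this]
    rw [integral_finsetSum _ fun i _ => integrable_finsetSum _ fun j _ => hint i j]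
    have hle : ∀ i ∈ Finset.range n,
        ∫ ω, ∑ j ∈ Finset.range n, D i ω * D j ω ∂μ ≤ C ^ 2 := fun i hi => by
      rw [integral_finsetSum _ fun j _ => hint i j, Finset.sum_eq_single_of_mem i hi]
      · calc ∫ ω, D i ω * D i ω ∂μ ≤ ∫ _, C ^ 2 ∂μ := by
              refine integral_mono (hint i i) (integrable_const _) fun ω => ?_
              have := hD i ω
              dsimp only
              rw [← sq, ← sq_abs]
              gcongr
          _ = C ^ 2 := by simp
      · intro j _ hj
        rcases lt_or_gt_of_ne hj with h | h
        · simp_rw [mul_comm (D i _)]; exact horth j i h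
        · exact horth i j h
    calc _ ≤ ∑ i ∈ Finset.range n, C ^ 2 := Finset.sum_le_sum hle
      _ = C ^ 2 * n := by simp [mul_comm]
  have hSmeas : ∀ n, Measurable fun ω => ∑ j ∈ Finset.range n, D j ω := fun n =>
    Finset.measurable_fun_sum _ fun j _ => hmeas j
  set Y : ℕ → Ω → ℝ := fun k ω => ((∑ j ∈ Finset.range (k ^ 2), D j ω) / (k : ℝ) ^ 2) ^ 2
  have hYmeas : ∀ k, Measurable (Y k) := fun k => ((hSmeas _).div_const _).pow_const 2
  have hYint : ∀ k, ∫⁻ ω, ENNReal.ofReal (Y k ω) ∂μ ≤ ENNReal.ofReal (C ^ 2 * (1 / (k : ℝ) ^ 2)) := by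
    intro k
    have hi : Integrable (Y k) μ := by
      have : Y k = fun ω => (∑ i ∈ Finset.range (k ^ 2), ∑ j ∈ Finset.range (k ^ 2),
          D i ω * D j ω) * (1 / ((k : ℝ) ^ 2) ^ 2) := by
        funext ω; simp only [Y]; rw [div_pow, sq (∑ j ∈ _, _), Finset.sum_mul_sum]; ring
      rw [this]
      exact (integrable_finsetSum _ fun i _ => integrable_finsetSum _ fun j _ => hint i j).mul_const _
    rw [← ofReal_integral_eq_lintegral_ofReal hi (ae_of_all _ fun ω => sq_nonneg _)]
    refine ENNReal.ofReal_le_ofReal ?_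
    simp only [Y, div_pow, integral_div]
    rcases Nat.eq_zero_or_pos k with rfl | hk
    · simp
    have hkR : (0 : ℝ) < k := by exact_mod_cast hk
    rw [div_le_iff₀ (by positivity)]
    refine (hsq _).trans (le_of_eq ?_)
    push_cast
    field_simp
  -- Along squares the second moments are at most `C ^ 2 / k ^ 2`. Their sum is finite, so almost
  -- surely `∑ Y k` converges and its terms tend to `0`.
  have hfin : ∫⁻ ω, ∑' k, ENNReal.ofReal (Y k ω) ∂μ ≠ ⊤ := by
    rw [lintegral_tsum fun k => (hYmeas k).ennreal_ofReal.aemeasurable]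
    have hs : Summable fun k : ℕ => C ^ 2 * (1 / (k : ℝ) ^ 2) :=
      (Real.summable_one_div_nat_pow.2 one_lt_two).mul_left _
    refine ne_top_of_le_ne_top ?_ (ENNReal.tsum_le_tsum hYint)
    rw [← ENNReal.ofReal_tsum_of_nonneg (fun k => by positivity) hs]
    exact ENNReal.ofReal_ne_top
  have hae := ae_lt_top (Measurable.tsum fun k => (hYmeas k).ennreal_ofReal) hfin
  filter_upwards [hae] with ω hω
  refine tendsto_sum_div_of_tendsto_squares (fun j => hD j ω) ?_
  have h0 := ENNReal.tendsto_atTop_zero_of_tsum_ne_top hω.ne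
  have h1 := (ENNReal.tendsto_toReal ENNReal.zero_ne_top).comp h0
  have h2 : Tendsto (fun k => Y k ω) atTop (𝓝 0) := by
    refine h1.congr fun k => ?_
    exact ENNReal.toReal_ofReal (sq_nonneg _)
  have h3 := (Real.continuous_sqrt.tendsto 0).comp h2
  rw [Real.sqrt_zero] at h3
  refine (tendsto_zero_iff_abs_tendsto_zero _).2 (h3.congr fun k => ?_)
  exact Real.sqrt_sq_eq_abs _

/-! ### Lattice paths and the random walk -/

/-- `p` is a path in `ℕ × ℕ` from the origin with steps `(1, 0)` and `(0, 1)`; the value `ξ j`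
is `1` if the `j`-th step is `(1, 0)`, and `0` otherwise. -/
structure IsLatticePath (p : ℕ → ℕ × ℕ) (ξ : ℕ → ℝ) : Prop where
  start : p 0 = 0
  step : ∀ j, (ξ j = 1 ∧ p (j + 1) = p j + (1, 0)) ∨ (ξ j = 0 ∧ p (j + 1) = p j + (0, 1))

/-- The average of `f (p j) * (ξ j - α)` tends to zero. -/
def StepBalanced (α : ℝ) (p : ℕ → ℕ × ℕ) (ξ : ℕ → ℝ) (f : ℕ × ℕ → ℝ) : Prop :=
  Tendsto (fun n : ℕ => (∑ j ∈ Finset.range n, f (p j) * (ξ j - α)) / (n : ℝ)) atTop (𝓝 0)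

/-- The indicator of the step `(1, 0)`. -/
noncomputable def rightStep (w : ℕ × ℕ) : ℝ := if w = (1, 0) then 1 else 0

theorem abs_rightStep_sub_le {α : ℝ} (hα₀ : 0 < α) (hα₁ : α < 1) (w : ℕ × ℕ) :
    |rightStep w - α| ≤ 1 := by
  unfold rightStep
  rw [abs_le]
  split_ifs <;> constructor <;> linarith

theorem integral_rightStep_sub {Ω : Type*} [MeasurableSpace Ω] {μ : Measure Ω}
    [IsProbabilityMeasure μ] {α : ℝ} (hα₀ : 0 < α) {W : Ω → ℕ × ℕ} (hW : Measurable W)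
    (h : μ {ω | W ω = (1, 0)} = ENNReal.ofReal α) : ∫ ω, (rightStep (W ω) - α) ∂μ = 0 := by
  have hs : MeasurableSet {ω | W ω = (1, 0)} := hW (measurableSet_singleton _)
  have he : (fun ω => rightStep (W ω)) = {ω | W ω = (1, 0)}.indicator 1 := by
    funext ω
    simp [rightStep, Set.indicator]
  have hi : Integrable (fun ω => rightStep (W ω)) μ := by
    rw [he]
    exact (integrable_const (1 : ℝ)).indicator hs
  rw [integral_sub hi (integrable_const _), he, integral_indicator_one hs]
  simp [Measure.real, h, hα₀.le]

/-- Both positions and the `i`-th step are functions of the steps before time `j`; the remaining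
factor is independent of these and has mean zero. -/
theorem integral_orthogonal_of_iIndepFun {Ω : Type*} [MeasurableSpace Ω] {μ : Measure Ω}
    [IsProbabilityMeasure μ] {α : ℝ} (hα₀ : 0 < α)
    {W : ℕ → Ω → ℕ × ℕ} (hW : ∀ i, Measurable (W i)) (hind : iIndepFun W μ)
    (hR : ∀ i, μ {ω | W i ω = (1, 0)} = ENNReal.ofReal α) (f : ℕ × ℕ → ℝ) {i j : ℕ} (hij : i < j) :
    ∫ ω, f (∑ k ∈ Finset.range i, W k ω) * (rightStep (W i ω) - α) *
      (f (∑ k ∈ Finset.range j, W k ω) * (rightStep (W j ω) - α)) ∂μ = 0 := by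
  -- Extension by zero lets partial sums be taken over `Finset.range` without membership proofs.
  let ext : ℕ → (Finset.range j → ℕ × ℕ) → ℕ × ℕ := fun k w =>
    if h : k ∈ Finset.range j then w ⟨k, h⟩ else 0
  have hext : ∀ k, Measurable (ext k) := fun k => by
    by_cases h : k ∈ Finset.range j
    · simpa only [ext, h, dif_pos] using measurable_pi_apply _
    · simpa only [ext, h, dif_neg, not_false_eq_true] using measurable_const
  have hextW : ∀ k < j, ∀ ω, ext k (fun i : Finset.range j => W i ω) = W k ω := fun k hk ω => by
    simp [ext, hk]
  let past : (Finset.range j → ℕ × ℕ) → ℝ := fun w =>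
    f (∑ k ∈ Finset.range i, ext k w) * (rightStep (ext i w) - α) *
      f (∑ k ∈ Finset.range j, ext k w)
  have hsum : ∀ n, Measurable fun w => ∑ k ∈ Finset.range n, ext k w := fun n =>
    Finset.measurable_fun_sum _ fun k _ => hext k
  have hpast : Measurable past :=
    ((Measurable.of_discrete (f := f)).comp (hsum i)).mul
      (((Measurable.of_discrete (f := rightStep)).comp (hext i)).sub_const α) |>.mul
      ((Measurable.of_discrete (f := f)).comp (hsum j))
  let now : (({j} : Finset ℕ) → ℕ × ℕ) → ℝ := fun w =>
    rightStep (w ⟨j, Finset.mem_singleton_self j⟩) - α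
  have hnow : Measurable now :=
    ((Measurable.of_discrete (f := rightStep)).comp (measurable_pi_apply _)).sub_const α
  have hI := (hind.indepFun_finset (Finset.range j) {j} (by simp) hW).comp hpast hnow
  have hm := hI.integral_fun_mul_eq_mul_integral
    (hpast.comp (measurable_pi_lambda _ fun k => hW k)).aestronglyMeasurable
    (hnow.comp (measurable_pi_lambda _ fun k => hW k)).aestronglyMeasurable
  have hz : ∫ ω, (now ∘ fun a (i : ({j} : Finset ℕ)) => W i a) ω ∂μ = 0 :=
    integral_rightStep_sub hα₀ (hW j) (hR j)
  rw [hz, mul_zero] at hm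
  rw [← hm]
  congr 1
  funext ω
  have hs : ∀ n ≤ j, ∑ k ∈ Finset.range n, ext k (fun i : Finset.range j => W i ω)
      = ∑ k ∈ Finset.range n, W k ω := fun n hn =>
    Finset.sum_congr rfl fun k hk => hextW k ((Finset.mem_range.1 hk).trans_le hn) ω
  simp only [Function.comp, past, now, hs i hij.le, hs j le_rfl, hextW i hij]
  ring

/-- Separates probability from the deterministic argument. The exceptional null set depends on `f`,
so only countably many `f` can be used at once. -/
theorem IsAlphaRandomWalk.exists_steps {Ω : Type*} [MeasurableSpace Ω] {μ : Measure Ω}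
    [IsProbabilityMeasure μ] {α : ℝ} (hα₀ : 0 < α) (hα₁ : α < 1) {P : ℕ → Ω → ℕ × ℕ}
    (hP : IsAlphaRandomWalk μ α P) :
    ∃ ξ : ℕ → Ω → ℝ, (∀ᵐ ω ∂μ, IsLatticePath (fun i => P i ω) (fun i => ξ i ω)) ∧
      ∀ (f : ℕ × ℕ → ℝ) (C : ℝ), (∀ x, |f x| ≤ C) →
        ∀ᵐ ω ∂μ, StepBalanced α (fun i => P i ω) (fun i => ξ i ω) f := by
  obtain ⟨W, hW, hind, hR, hU, hstep⟩ := hP.steps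
  have hPW : ∀ n ω, P n ω = ∑ k ∈ Finset.range n, W k ω := fun n ω => by
    induction n with
    | zero => rw [hP.start]; rfl
    | succ n ih => rw [hstep, ih, Finset.sum_range_succ]
  refine ⟨fun i ω => rightStep (W i ω), ?_, fun f C hf => ?_⟩
  · have hae : ∀ i, ∀ᵐ ω ∂μ, W i ω = (1, 0) ∨ W i ω = (0, 1) := fun i => by
      have hR' : MeasurableSet {ω | W i ω = (1, 0)} := hW i (measurableSet_singleton _)
      have hU' : MeasurableSet {ω | W i ω = (0, 1)} := hW i (measurableSet_singleton _)
      have hdisj : Disjoint {ω | W i ω = (1, 0)} {ω | W i ω = (0, 1)} := by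
        rw [Set.disjoint_left]
        intro ω h1 h2
        simp only [Set.mem_ofPred_eq] at h1 h2
        simp [h1] at h2
      have hone : μ ({ω | W i ω = (1, 0)} ∪ {ω | W i ω = (0, 1)}) = 1 := by
        rw [measure_union hdisj hU', hR, hU, ← ENNReal.ofReal_add hα₀.le (by linarith)]
        simp
      exact (mem_ae_iff_prob_eq_one (hR'.union hU')).2 hone
    filter_upwards [ae_all_iff.2 hae] with ω hω
    refine ⟨hP.start ω, fun j => ?_⟩
    rcases hω j with h | h
    · left; simp [rightStep, h, hstep]
    · right; simp [rightStep, h, hstep]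
  · have hmeas : ∀ j, Measurable fun ω => f (P j ω) * (rightStep (W j ω) - α) := fun j => by
      simp_rw [hPW]
      exact ((Measurable.of_discrete (f := f)).comp
        (Finset.measurable_fun_sum _ fun k _ => hW k)).mul
        (((Measurable.of_discrete (f := rightStep)).comp (hW j)).sub_const α)
    refine ae_tendsto_avg_of_orthogonal (C := C) hmeas (fun j ω => ?_) fun i j hij => ?_
    · rw [abs_mul]
      calc _ ≤ C * 1 := mul_le_mul (hf _) (abs_rightStep_sub_le hα₀ hα₁ _) (abs_nonneg _)
            ((abs_nonneg _).trans (hf 0))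
        _ = C := mul_one C
    · simp_rw [hPW]
      exact integral_orthogonal_of_iIndepFun hα₀ hW hind hR f hij

/-! ### The Poisson equation on a finite quotient -/

/-- The transition operator, on functions on an additive group, of the walk with step `a` with
weight `α` and step `b` with weight `1 - α`, subtracted from the identity. -/
def walkLaplacian {A : Type*} [AddCommGroup A] (α : ℝ) (a b : A) : (A → ℝ) →ₗ[ℝ] (A → ℝ) where
  toFun g x := g x - (α * g (x + a) + (1 - α) * g (x + b))
  map_add' g g' := by funext x; simp only [Pi.add_apply]; ring
  map_smul' c g := by funext x; simp only [Pi.smul_apply, smul_eq_mul, RingHom.id_apply]; ring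

/-- A function annihilated by the walk Laplacian is constant (the maximum principle). -/
theorem eq_const_of_walkLaplacian_eq_zero {A : Type*} [AddCommGroup A] [Finite A] {α : ℝ}
    (hα₀ : 0 < α) (hα₁ : α < 1) {π : ℕ × ℕ →+ A} (hπ : Function.Surjective π) {g : A → ℝ}
    (hg : walkLaplacian α (π (1, 0)) (π (0, 1)) g = 0) : ∃ c, ∀ x, g x = c := by
  obtain ⟨x₀, hx₀⟩ := Finite.exists_max g
  -- Both weights are positive, so a weighted mean equal to the maximum forces both values to be
  -- maximal.
  have key : ∀ x, g x = g x₀ → g (x + π (1, 0)) = g x₀ ∧ g (x + π (0, 1)) = g x₀ := fun x hx => by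
    have h := congrFun hg x
    simp only [walkLaplacian, LinearMap.coe_mk, AddHom.coe_mk, Pi.zero_apply] at h
    have h1 := hx₀ (x + π (1, 0))
    have h2 := hx₀ (x + π (0, 1))
    constructor <;> nlinarith
  have hR : ∀ m : ℕ, g (x₀ + π (m, 0)) = g x₀ := fun m => by
    induction m with
    | zero => rw [show ((0 : ℕ), (0 : ℕ)) = 0 from rfl, map_zero, add_zero]
    | succ m ih =>
      rw [show ((m + 1 : ℕ), (0 : ℕ)) = (m, 0) + (1, 0) by simp, map_add, ← add_assoc]
      exact (key _ ih).1
  have hU : ∀ m n : ℕ, g (x₀ + π (m, n)) = g x₀ := fun m n => by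
    induction n with
    | zero => exact hR m
    | succ n ih =>
      rw [show (m, (n + 1 : ℕ)) = (m, n) + (0, 1) by simp, map_add, ← add_assoc]
      exact (key _ ih).2
  refine ⟨g x₀, fun x => ?_⟩
  obtain ⟨⟨m, n⟩, hmn⟩ := hπ (x - x₀)
  rw [← hU m n, hmn, add_sub_cancel]

/-- Translation invariance of the sum puts the range of the Laplacian inside the sum-zero functions.
Its kernel is at most the line of constants, so by rank-nullity the two spaces coincide. -/
theorem exists_walkLaplacian_eq {A : Type*} [AddCommGroup A] [Fintype A] {α : ℝ}
    (hα₀ : 0 < α) (hα₁ : α < 1) {π : ℕ × ℕ →+ A} (hπ : Function.Surjective π) {F : A → ℝ}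
    (hF : ∑ x, F x = 0) : ∃ g, walkLaplacian α (π (1, 0)) (π (0, 1)) g = F := by
  classical
  set T := walkLaplacian α (π (1, 0)) (π (0, 1))
  let s : (A → ℝ) →ₗ[ℝ] ℝ := ∑ x, LinearMap.proj x
  have hs : ∀ g, s g = ∑ x, g x := fun g => by simp [s]
  have hle : LinearMap.range T ≤ LinearMap.ker s := by
    rintro _ ⟨g, rfl⟩
    rw [LinearMap.mem_ker, hs]
    simp only [T, walkLaplacian, LinearMap.coe_mk, AddHom.coe_mk, Finset.sum_sub_distrib,
      Finset.sum_add_distrib, ← Finset.mul_sum]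
    rw [Fintype.sum_equiv (Equiv.addRight (π (1, 0))) (fun x => g (x + π (1, 0))) g fun _ => rfl,
      Fintype.sum_equiv (Equiv.addRight (π (0, 1))) (fun x => g (x + π (0, 1))) g fun _ => rfl]
    ring
  have hker : Module.finrank ℝ (LinearMap.ker T) ≤ 1 := by
    refine finrank_le_one ⟨fun _ => 1, ?_⟩ fun g => ?_
    · funext x; simp [T, walkLaplacian]
    · obtain ⟨c, hc⟩ := eq_const_of_walkLaplacian_eq_zero hα₀ hα₁ hπ (LinearMap.mem_ker.1 g.2)
      refine ⟨c, Subtype.ext ?_⟩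
      funext x
      simp [hc x]
  have hsurj : Module.finrank ℝ (LinearMap.range s) = 1 := by
    have : LinearMap.range s = ⊤ := by
      refine LinearMap.range_eq_top.2 fun c => ⟨Pi.single 0 c, ?_⟩
      rw [hs]
      simp
    rw [this, finrank_top, Module.finrank_self]
  have h1 := LinearMap.finrank_range_add_finrank_ker T
  have h2 := LinearMap.finrank_range_add_finrank_ker s
  have heq : LinearMap.range T = LinearMap.ker s :=
    Submodule.eq_of_le_of_finrank_le hle (by omega)
  have hmem : F ∈ LinearMap.range T := by
    rw [heq, LinearMap.mem_ker, hs, hF]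
  exact hmem

theorem tendsto_div_of_abs_le {u : ℕ → ℝ} {C : ℝ} (hu : ∀ n, |u n| ≤ C) :
    Tendsto (fun n : ℕ => u n / (n : ℝ)) atTop (𝓝 0) := by
  have h := (tendsto_inv_atTop_nhds_zero_nat (𝕜 := ℝ)).const_mul C
  rw [mul_zero] at h
  refine squeeze_zero_norm (fun n => ?_) h
  rw [Real.norm_eq_abs, abs_div, div_eq_mul_inv, Nat.abs_cast]
  exact mul_le_mul_of_nonneg_right (hu n) (by positivity)

/-- A function of the position of the walk in a finite quotient has, along almost every path, the
mean over the quotient as its average. -/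
theorem tendsto_avg_of_quotient {A : Type*} [AddCommGroup A] [Fintype A] {α : ℝ}
    (hα₀ : 0 < α) (hα₁ : α < 1) {π : ℕ × ℕ →+ A} (hπ : Function.Surjective π) (F : A → ℝ) :
    ∃ f : ℕ × ℕ → ℝ, (∃ C, ∀ x, |f x| ≤ C) ∧ ∀ (p : ℕ → ℕ × ℕ) (ξ : ℕ → ℝ), IsLatticePath p ξ →
      StepBalanced α p ξ f → Tendsto (fun n : ℕ => (∑ j ∈ Finset.range n, F (π (p j))) / (n : ℝ))
        atTop (𝓝 ((∑ x, F x) / Fintype.card A)) := by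
  set m := (∑ x, F x) / Fintype.card A with hm
  have hcard : (Fintype.card A : ℝ) ≠ 0 := by
    have : 0 < Fintype.card A := Fintype.card_pos_iff.2 ⟨0⟩
    positivity
  obtain ⟨g, hg⟩ := exists_walkLaplacian_eq hα₀ hα₁ hπ (F := fun x => F x - m) (by
    rw [Finset.sum_sub_distrib, Finset.sum_const, Finset.card_univ, nsmul_eq_mul, hm,
      mul_div_cancel₀ _ hcard, sub_self])
  obtain ⟨x₀, hx₀⟩ := Finite.exists_max fun x => |g x|
  have hbd : ∀ x y, |g x - g y| ≤ 2 * |g x₀| := fun x y => by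
    have := abs_sub (g x) (g y)
    have h1 := hx₀ x
    have h2 := hx₀ y
    linarith
  refine ⟨fun q => g (π q + π (1, 0)) - g (π q + π (0, 1)), ⟨_, fun q => hbd _ _⟩,
    fun p ξ hp hbal => ?_⟩
  -- At `x = π (p j)` the next value of `g` is `g (x + π (0, 1))` plus `ξ j` times the difference of
  -- the two possible values; the Poisson equation has `α` in place of `ξ j`.
  have hstep : ∀ j, F (π (p j)) - m = (g (π (p j)) - g (π (p (j + 1)))) +
      (g (π (p j) + π (1, 0)) - g (π (p j) + π (0, 1))) * (ξ j - α) := fun j => by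
    have h := congrFun hg (π (p j))
    simp only [walkLaplacian, LinearMap.coe_mk, AddHom.coe_mk] at h
    rw [← h]
    rcases hp.step j with ⟨h1, h2⟩ | ⟨h1, h2⟩
    · rw [h1, h2, map_add]; ring
    · rw [h1, h2, map_add]; ring
  have htel : Tendsto (fun n : ℕ => (g (π (p 0)) - g (π (p n))) / (n : ℝ)) atTop (𝓝 0) :=
    tendsto_div_of_abs_le fun n => hbd _ _
  have hsum := (htel.add hbal).add_const m
  rw [add_zero, zero_add] at hsum
  refine hsum.congr' ?_
  filter_upwards [eventually_ge_atTop 1] with n hn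
  have hn' : (n : ℝ) ≠ 0 := by positivity
  have : ∑ j ∈ Finset.range n, F (π (p j)) = (g (π (p 0)) - g (π (p n))) +
      ∑ j ∈ Finset.range n, (g (π (p j) + π (1, 0)) - g (π (p j) + π (0, 1))) * (ξ j - α)
      + n * m := by
    rw [← Finset.sum_range_sub' (fun j => g (π (p j))), ← Finset.sum_add_distrib]
    simp_rw [← hstep]
    simp
  rw [this]
  field_simp

/-! ### Finitely many moduli and the Chinese remainder theorem -/

theorem card_image_intCast_zmod (H : Finset ℤ) (g : ℕ) [NeZero g] :
    (H.image (fun h : ℤ => (h : ZMod g))).card = residueCount H g := by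
  have hinj : Function.Injective fun x : ZMod g => (x.val : ℤ) := fun x y h =>
    ZMod.val_injective g (Nat.cast_injective (R := ℤ) h)
  rw [residueCount, ← Finset.card_image_of_injective _ hinj, Finset.image_image]
  congr 1
  refine Finset.image_congr fun h _ => ?_
  exact ZMod.val_intCast h

theorem residueCount_le (H : Finset ℤ) (g : ℕ) : residueCount H g ≤ H.card :=
  Finset.card_image_le

/-- The tuples of residues that avoid every class of `H`. -/
noncomputable def survivors (s : Finset ℕ) (H : Finset ℤ) [∀ g : s, NeZero (g : ℕ)] :
    Finset (∀ g : s, ZMod (g : ℕ)) :=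
  Fintype.piFinset fun g => (H.image (fun h : ℤ => (h : ZMod (g : ℕ))))ᶜ

theorem natCast_mem_survivors (s : Finset ℕ) (H : Finset ℤ) [∀ g : s, NeZero (g : ℕ)] (n : ℕ) :
    (n : ∀ g : s, ZMod (g : ℕ)) ∈ survivors s H ↔ n ∈ sievedSet (s : Set ℕ) H := by
  simp only [survivors, Fintype.mem_piFinset, Finset.mem_compl, Finset.mem_image, not_exists,
    not_and, Pi.natCast_apply, sievedSet, Set.mem_ofPred_eq]
  constructor
  · intro h a ha g hg hcon
    refine h ⟨g, hg⟩ a ha ?_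
    have := (ZMod.intCast_eq_intCast_iff _ _ g).2 hcon
    simpa using this.symm
  · intro h g a ha hcon
    refine h a ha g g.2 ((ZMod.intCast_eq_intCast_iff _ _ _).1 ?_)
    simpa using hcon.symm

theorem card_survivors_div (s : Finset ℕ) (H : Finset ℤ) [∀ g : s, NeZero (g : ℕ)] :
    ((survivors s H).card : ℝ) / Fintype.card (∀ g : s, ZMod (g : ℕ)) =
      ∏ g ∈ s, (1 - (residueCount H g : ℝ) / (g : ℝ)) := by
  rw [survivors, Fintype.card_piFinset, Fintype.card_pi, Nat.cast_prod, Nat.cast_prod,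
    ← Finset.prod_div_distrib, ← Finset.prod_coe_sort s]
  refine Finset.prod_congr rfl fun g _ => ?_
  have hg : ((g : ℕ) : ℝ) ≠ 0 := Nat.cast_ne_zero.2 (NeZero.ne _)
  rw [Finset.card_compl, card_image_intCast_zmod, ZMod.card, Nat.cast_sub, sub_div, div_self hg]
  rw [← card_image_intCast_zmod]
  exact (Finset.card_le_univ _).trans_eq (ZMod.card _)

/-- The Chinese remainder theorem. Representatives must be natural numbers, because the maximum
principle propagates only along positive steps. -/
theorem natCast_pi_zmod_surjective {s : Finset ℕ} (hs : (s : Set ℕ).Pairwise Nat.Coprime)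
    [∀ g : s, NeZero (g : ℕ)] : Function.Surjective (Nat.cast : ℕ → ∀ g : s, ZMod (g : ℕ)) := by
  intro y
  have hco : Pairwise (Function.onFun Nat.Coprime fun g : s => (g : ℕ)) := fun a b hab =>
    hs a.2 b.2 fun h => hab (Subtype.ext h)
  let e := ZMod.prodEquivPi (fun g : s => (g : ℕ)) hco
  have : NeZero (∏ g : s, (g : ℕ)) := ⟨Finset.prod_ne_zero_iff.2 fun g _ => NeZero.ne _⟩
  refine ⟨(e.symm y).val, ?_⟩
  rw [← map_natCast e, ZMod.natCast_zmod_val, RingEquiv.apply_symm_apply]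

theorem tendsto_avg_sievedSet_finset {s₁ s₂ : Finset ℕ}
    (hs₁ : (s₁ : Set ℕ).Pairwise Nat.Coprime) (hs₂ : (s₂ : Set ℕ).Pairwise Nat.Coprime)
    (h0₁ : ∀ g ∈ s₁, g ≠ 0) (h0₂ : ∀ g ∈ s₂, g ≠ 0) (H₁ H₂ : Finset ℤ) {α : ℝ}
    (hα₀ : 0 < α) (hα₁ : α < 1) :
    ∃ f : ℕ × ℕ → ℝ, (∃ C, ∀ x, |f x| ≤ C) ∧ ∀ (p : ℕ → ℕ × ℕ) (ξ : ℕ → ℝ), IsLatticePath p ξ →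
      StepBalanced α p ξ f → Tendsto (fun n : ℕ => (∑ j ∈ Finset.range n,
        (sievedSet (s₁ : Set ℕ) H₁ ×ˢ sievedSet (s₂ : Set ℕ) H₂).indicator (fun _ => (1 : ℝ)) (p j))
          / (n : ℝ)) atTop (𝓝 ((∏ g ∈ s₁, (1 - (residueCount H₁ g : ℝ) / (g : ℝ))) *
            ∏ g ∈ s₂, (1 - (residueCount H₂ g : ℝ) / (g : ℝ)))) := by
  have : ∀ g : s₁, NeZero (g : ℕ) := fun g => ⟨h0₁ g g.2⟩
  have : ∀ g : s₂, NeZero (g : ℕ) := fun g => ⟨h0₂ g g.2⟩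
  let π : ℕ × ℕ →+ (∀ g : s₁, ZMod (g : ℕ)) × (∀ g : s₂, ZMod (g : ℕ)) :=
    (Nat.castAddMonoidHom _).prodMap (Nat.castAddMonoidHom _)
  have hπ : Function.Surjective π :=
    (natCast_pi_zmod_surjective hs₁).prodMap (natCast_pi_zmod_surjective hs₂)
  let F : (∀ g : s₁, ZMod (g : ℕ)) × (∀ g : s₂, ZMod (g : ℕ)) → ℝ := fun x =>
    if x ∈ survivors s₁ H₁ ×ˢ survivors s₂ H₂ then 1 else 0
  obtain ⟨f, hf, h⟩ := tendsto_avg_of_quotient hα₀ hα₁ hπ F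
  refine ⟨f, hf, fun p ξ hp hb => ?_⟩
  have hlim := h p ξ hp hb
  have hF : (∑ x, F x) / Fintype.card ((∀ g : s₁, ZMod (g : ℕ)) × (∀ g : s₂, ZMod (g : ℕ)))
      = (∏ g ∈ s₁, (1 - (residueCount H₁ g : ℝ) / (g : ℝ))) *
            ∏ g ∈ s₂, (1 - (residueCount H₂ g : ℝ) / (g : ℝ)) := by
    rw [← card_survivors_div, ← card_survivors_div, Fintype.card_prod]
    simp only [F, Finset.sum_boole, Finset.filter_univ_mem, Finset.card_product, Nat.cast_mul]
    rw [mul_div_mul_comm]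
  rw [hF] at hlim
  refine hlim.congr fun n => ?_
  congr 1
  refine Finset.sum_congr rfl fun j _ => ?_
  have : π (p j) ∈ survivors s₁ H₁ ×ˢ survivors s₂ H₂ ↔
      p j ∈ sievedSet (s₁ : Set ℕ) H₁ ×ˢ sievedSet (s₂ : Set ℕ) H₂ := by
    rw [Finset.mem_product, Set.mem_prod, ← natCast_mem_survivors, ← natCast_mem_survivors]
    rfl
  classical
  simp only [F, this, Set.indicator_apply]

/-! ### Summable reciprocals and the large moduli -/

/-- The function `1 / n` on `G`, extended by zero. -/
noncomputable def recipOn (G : Set ℕ) : ℕ → ℝ := G.indicator fun n => (n : ℝ)⁻¹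

theorem recipOn_nonneg (G : Set ℕ) (n : ℕ) : 0 ≤ recipOn G n :=
  Set.indicator_nonneg (fun _ _ => by positivity) n

/-- Each element of `G` is a one-element product. Take `x = n ^ (1 / A)` and `y = n`: then `x ^ A =
n`, while `x ^ ε ≤ n` because `ε < A`. -/
theorem ConditionA.card_isBigO {G : Set ℕ} {θ A ε : ℝ} (hε : 0 < ε) (hεA : ε < A)
    (hA : ConditionA θ A ε (truncProductSet G A)) :
    (fun n : ℕ => ∑ k ∈ Finset.Icc 1 n, G.indicator (fun _ => (1 : ℝ)) k) =O[atTop]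
      fun n : ℕ => (n : ℝ) ^ θ := by
  have hA0 : 0 < A := hε.trans hεA
  obtain ⟨C, hC⟩ := hA.card_le
  have hx : Tendsto (fun n : ℕ => (n : ℝ) ^ A⁻¹) atTop atTop :=
    (tendsto_rpow_atTop (inv_pos.2 hA0)).comp tendsto_natCast_atTop_atTop
  refine Asymptotics.IsBigO.of_bound |C| ?_
  filter_upwards [hx.eventually hC, eventually_ge_atTop 3] with n hn h3
  have hn1 : (1 : ℝ) ≤ n := by exact_mod_cast (by omega : 1 ≤ n)
  have hn0 : (0 : ℝ) ≤ n := by positivity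
  have hpow : ((n : ℝ) ^ A⁻¹) ^ A = n := by
    rw [← Real.rpow_mul hn0, inv_mul_cancel₀ hA0.ne', Real.rpow_one]
  have hle : ((n : ℝ) ^ A⁻¹) ^ ε ≤ n := by
    rw [← Real.rpow_mul hn0]
    refine (Real.rpow_le_rpow_of_exponent_le hn1 ?_).trans_eq (Real.rpow_one _)
    rw [inv_mul_le_iff₀ hA0]
    linarith
  have hcard := hn n hle
  classical
  have hsum : ∑ k ∈ Finset.Icc 1 n, G.indicator (fun _ => (1 : ℝ)) k
      = (((Finset.Icc 1 n).filter (· ∈ G)).card : ℝ) := by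
    simp only [Set.indicator_apply, Finset.sum_boole]
  have hsub : (((Finset.Icc 1 n).filter (· ∈ G)).card : ℝ) ≤
      (({a | a ∈ truncProductSet G A ((n : ℝ) ^ A⁻¹) ∧ 1 ≤ a ∧ (a : ℝ) ≤ n} : Set ℕ).ncard : ℝ) := by
    rw [← Set.ncard_coe_finset]
    refine Nat.cast_le.2 (Set.ncard_le_ncard ?_ ?_)
    · intro g hg
      simp only [Finset.coe_filter, Finset.mem_Icc, Set.mem_ofPred_eq] at hg
      obtain ⟨⟨h1, h2⟩, hgG⟩ := hg
      have h2' : (g : ℝ) ≤ n := by exact_mod_cast h2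
      exact ⟨⟨⟨{g}, by simpa using hgG, by simp⟩, by rw [hpow]; exact h2'⟩, h1, h2'⟩
    · refine (Set.finite_Iic n).subset fun a ha => ?_
      exact_mod_cast ha.2.2
  -- From `n ≥ 3 > e` on, the logarithmic denominator is at least `1` and can be dropped.
  have hlog : 1 ≤ Real.log n := by
    rw [Real.le_log_iff_exp_le (by positivity)]
    have : (3 : ℝ) ≤ n := by exact_mod_cast h3
    linarith [Real.exp_one_lt_d9]
  rw [Real.norm_eq_abs, Real.norm_eq_abs, hsum, abs_of_nonneg (Nat.cast_nonneg _),
    abs_of_nonneg (Real.rpow_nonneg hn0 _)]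
  have hq : (n : ℝ) ^ θ / Real.log n ^ A ≤ (n : ℝ) ^ θ :=
    div_le_self (Real.rpow_nonneg hn0 _) (Real.one_le_rpow hlog hA0.le)
  have hq0 : 0 ≤ (n : ℝ) ^ θ / Real.log n ^ A :=
    div_nonneg (Real.rpow_nonneg hn0 _) (Real.rpow_nonneg (by linarith) _)
  calc _ ≤ _ := hsub
    _ ≤ C * ((n : ℝ) ^ θ / Real.log n ^ A) := hcard
    _ ≤ |C| * ((n : ℝ) ^ θ / Real.log n ^ A) := mul_le_mul_of_nonneg_right (le_abs_self C) hq0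
    _ ≤ |C| * (n : ℝ) ^ θ := mul_le_mul_of_nonneg_left hq (abs_nonneg C)

/-- Partial summation, in the form of convergence at `s = 1` of the Dirichlet series of the
indicator of `G`. -/
theorem ConditionA.summable_recipOn {G : Set ℕ} {θ A ε : ℝ} (hθ : θ < 1) (hε : 0 < ε)
    (hεA : ε < A) (hA : ConditionA θ A ε (truncProductSet G A)) : Summable (recipOn G) := by
  have h := LSeriesSummable_of_sum_norm_bigO_and_nonneg (s := 1) (hA.card_isBigO hε hεA)
    (fun n => Set.indicator_nonneg (fun _ _ => zero_le_one) n) hA.theta_pos.le (by simpa using hθ)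
  refine h.norm.congr fun n => ?_
  rw [LSeries.term_def]
  rcases eq_or_ne n 0 with rfl | hn
  · by_cases h0 : 0 ∈ G <;> simp [recipOn, Set.indicator, h0]
  · by_cases hG : n ∈ G <;> simp [recipOn, hn, hG]

/-- The sum of the reciprocals of the elements of `G` larger than `z`. -/
noncomputable def recipTail (G : Set ℕ) (z : ℕ) : ℝ := ∑' k, recipOn G (k + (z + 1))

theorem tendsto_recipTail (G : Set ℕ) : Tendsto (recipTail G) atTop (𝓝 0) :=
  (tendsto_sum_nat_add (recipOn G)).comp (tendsto_add_atTop_nat 1)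

theorem sum_Ioc_recipOn_le {G : Set ℕ} (hG : Summable (recipOn G)) (z N : ℕ) :
    ∑ g ∈ Finset.Ioc z N, recipOn G g ≤ recipTail G z := by
  have : Finset.Ioc z N = Finset.Ico (z + 1) (N + 1) := by ext; simp
  rw [this, Finset.sum_Ico_eq_sum_range]
  simp_rw [add_comm (z + 1)]
  exact ((summable_nat_add_iff (z + 1)).2 hG).sum_le_tsum _ fun k _ => recipOn_nonneg G _

theorem card_filter_range_modEq_le (n g : ℕ) (hg : 0 < g) (h : ℤ) :
    (((Finset.range n).filter fun m : ℕ => (m : ℤ) ≡ h [ZMOD g]).card : ℝ) ≤ n / g + 1 := by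
  have hle : ((Finset.range n).filter fun m : ℕ => (m : ℤ) ≡ h [ZMOD g]).card ≤
      ((Finset.Ico (0 : ℤ) n).filter fun m => m ≡ h [ZMOD g]).card := by
    refine Finset.card_le_card_of_injOn (fun m : ℕ => (m : ℤ)) (fun m hm => ?_)
      fun a _ b _ hab => Nat.cast_injective (R := ℤ) hab
    simp only [Finset.coe_filter, Finset.mem_range, Set.mem_ofPred_eq] at hm
    simp only [Finset.coe_filter, Finset.mem_Ico, Set.mem_ofPred_eq]
    exact ⟨⟨by positivity, by exact_mod_cast hm.1⟩, hm.2⟩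
  have hcard := Int.Ico_filter_modEq_card 0 (n : ℤ) (r := g) (by exact_mod_cast hg) h
  have hgQ : (0 : ℚ) < g := by exact_mod_cast hg
  have hQ : (((Finset.Ico (0 : ℤ) n).filter fun m => m ≡ h [ZMOD g]).card : ℚ) ≤ n / g + 1 := by
    rw [← Int.cast_natCast (R := ℚ), hcard, Int.cast_max]
    refine max_le ?_ (by push_cast; positivity)
    have h1 := Int.ceil_lt_add_one (((n : ℤ) - h : ℚ) / ((g : ℤ) : ℚ))
    have h2 := Int.le_ceil ((((0 : ℤ) : ℚ) - h) / ((g : ℤ) : ℚ))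
    push_cast at h1 h2 ⊢
    have : ((n : ℚ) - h) / g - (0 - h) / g = n / g := by field_simp; ring
    linarith
  have hR : (((Finset.Ico (0 : ℤ) n).filter fun m => m ≡ h [ZMOD g]).card : ℝ) ≤ n / g + 1 := by
    have := (Rat.cast_le (K := ℝ)).2 hQ
    push_cast at this
    exact this
  exact (Nat.cast_le.2 hle).trans hR

/-- The integers removed by the moduli of `G` larger than `z`. -/
def tailSet (G : Set ℕ) (H : Finset ℤ) (z : ℕ) : Set ℕ :=
  {m | ∃ g ∈ G, z < g ∧ ∃ h ∈ H, (m : ℤ) ≡ h [ZMOD (g : ℤ)]}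

theorem sum_indicator_tailSet_le {G : Set ℕ} (hG : Summable (recipOn G)) {H : Finset ℤ} {K : ℕ}
    (hK : ∀ h ∈ H, |h| ≤ K) (z n : ℕ) :
    ∑ m ∈ Finset.range n, (tailSet G H z).indicator (fun _ => (1 : ℝ)) m ≤
      H.card * ((2 * n + K) * recipTail G z + 1) := by
  classical
  let M : Finset ℕ := (Finset.Ioc z (n + K)).filter (· ∈ G)
  have hsub : (Finset.range n).filter (· ∈ tailSet G H z) ⊆ H.biUnion fun h => {h.toNat} ∪
      M.biUnion fun g => (Finset.range n).filter fun m : ℕ => (m : ℤ) ≡ h [ZMOD g] := by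
    intro m hm
    rw [Finset.mem_filter, Finset.mem_range] at hm
    obtain ⟨hmn, g, hg, hzg, h, hh, hmod⟩ := hm
    rw [Finset.mem_biUnion]
    refine ⟨h, hh, ?_⟩
    rw [Finset.mem_union, Finset.mem_singleton, Finset.mem_biUnion]
    -- A modulus above `n + K` exceeds `|h - m|`, so the congruence forces `m = h`: one exceptional
    -- integer for each `h`.
    by_cases hgn : g ≤ n + K
    · exact .inr ⟨g, by simp [M, hzg, hgn, hg], by simp [hmn, hmod]⟩
    · left
      have hd := hmod.dvd
      have hb := abs_le.1 (hK h hh)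
      have : h - m = 0 := Int.eq_zero_of_abs_lt_dvd hd (by rw [abs_lt]; constructor <;> omega)
      omega
  have hM : ∀ h : ℤ, ∑ g ∈ M, (((Finset.range n).filter fun m : ℕ =>
      (m : ℤ) ≡ h [ZMOD g]).card : ℝ) ≤ (2 * n + K) * recipTail G z := fun h => by
    calc _ ≤ ∑ g ∈ M, (2 * n + K) * recipOn G g := by
          refine Finset.sum_le_sum fun g hg => ?_
          simp only [M, Finset.mem_filter, Finset.mem_Ioc] at hg
          have hg0 : 0 < g := by omega
          have hgR : (0 : ℝ) < g := by exact_mod_cast hg0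
          have hgK : (g : ℝ) ≤ n + K := by exact_mod_cast hg.1.2
          -- Since `g ≤ n + K`, the rounding error `1` is absorbed: `n / g + 1 ≤ (2 * n + K) / g`.
          refine (card_filter_range_modEq_le n g hg0 h).trans ?_
          rw [recipOn, Set.indicator_of_mem hg.2, ← div_eq_mul_inv, le_div_iff₀ hgR, add_mul,
            div_mul_cancel₀ _ hgR.ne']
          linarith
      _ = (2 * n + K) * ∑ g ∈ M, recipOn G g := by rw [Finset.mul_sum]
      _ ≤ (2 * n + K) * recipTail G z := by
          refine mul_le_mul_of_nonneg_left ?_ (by positivity)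
          refine (Finset.sum_le_sum_of_subset_of_nonneg (Finset.filter_subset _ _)
            fun g _ _ => recipOn_nonneg G g).trans (sum_Ioc_recipOn_le hG z (n + K))
  calc ∑ m ∈ Finset.range n, (tailSet G H z).indicator (fun _ => (1 : ℝ)) m
      = (((Finset.range n).filter (· ∈ tailSet G H z)).card : ℝ) := by
        simp only [Set.indicator_apply, Finset.sum_boole]
    _ ≤ ∑ h ∈ H, (1 + ∑ g ∈ M, (((Finset.range n).filter fun m : ℕ =>
          (m : ℤ) ≡ h [ZMOD g]).card : ℝ)) := by
        have h1 := (Finset.card_le_card hsub).trans Finset.card_biUnion_le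
        refine (Nat.cast_le.2 h1).trans ?_
        rw [Nat.cast_sum]
        refine Finset.sum_le_sum fun h _ => ?_
        have h2 := (Finset.card_union_le {h.toNat} (M.biUnion fun g =>
          (Finset.range n).filter fun m : ℕ => (m : ℤ) ≡ h [ZMOD g])).trans
          (Nat.add_le_add_left Finset.card_biUnion_le _)
        exact_mod_cast h2
    _ ≤ ∑ h ∈ H, ((2 * n + K) * recipTail G z + 1) :=
        Finset.sum_le_sum fun h _ => by linarith [hM h]
    _ = _ := by rw [Finset.sum_const, nsmul_eq_mul]

/-! ### The infinite products and their truncations -/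

theorem multipliable_localFactor {G : Set ℕ} (hG : Summable (recipOn G)) (H : Finset ℤ) :
    Multipliable (localFactor G H) := by
  have h1 : Summable fun g : G => (((g : ℕ) : ℝ))⁻¹ :=
    (hG.comp_injective (Subtype.val_injective (p := (· ∈ G)))).congr fun g => by
      simp [recipOn, g.2]
  have h2 : Summable fun g : G => -((residueCount H (g : ℕ) : ℝ) / ((g : ℕ) : ℝ)) := by
    refine Summable.neg (Summable.of_nonneg_of_le (fun g => by positivity) (fun g => ?_)
      (h1.mul_left (H.card : ℝ)))
    rw [div_eq_mul_inv]
    have : (residueCount H (g : ℕ) : ℝ) ≤ H.card := by exact_mod_cast residueCount_le H g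
    gcongr
  exact (Real.multipliable_one_add_of_summable h2).congr fun g => (sub_eq_add_neg _ _).symm

open Classical in
/-- The elements of `G` that are at most `z`. -/
noncomputable def upTo (G : Set ℕ) (z : ℕ) : Finset ℕ := (Finset.range (z + 1)).filter (· ∈ G)

theorem mem_upTo {G : Set ℕ} {z g : ℕ} : g ∈ upTo G z ↔ g ≤ z ∧ g ∈ G := by
  simp [upTo]

theorem tendsto_prod_upTo {G : Set ℕ} {H : Finset ℤ} (h : Multipliable (localFactor G H)) :
    Tendsto (fun z => ∏ g ∈ upTo G z, (1 - (residueCount H g : ℝ) / (g : ℝ))) atTop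
      (𝓝 (sieveDensity G H)) := by
  classical
  have ht : Tendsto (fun z => (upTo G z).subtype (· ∈ G)) atTop atTop := by
    refine tendsto_atTop_finset_of_monotone (fun z w hzw g hg => ?_) fun g => ⟨g, ?_⟩
    · rw [Finset.mem_subtype, mem_upTo] at hg ⊢
      exact ⟨hg.1.trans hzw, hg.2⟩
    · rw [Finset.mem_subtype, mem_upTo]
      exact ⟨le_rfl, g.2⟩
  refine (h.hasProd.comp ht).congr fun z => ?_
  exact Finset.prod_subtype_of_mem (fun g : ℕ => 1 - (residueCount H g : ℝ) / (g : ℝ))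
    fun g hg => (mem_upTo.1 hg).2

/-! ### Visits of one coordinate to the tail set -/

/-- Weighting by `η j` keeps only the times at which the coordinate leaves its value, and each value
below `X n` is left exactly once before time `n`. -/
theorem sum_mul_step_eq {X : ℕ → ℕ} {η : ℕ → ℝ} (h0 : X 0 = 0)
    (hX : ∀ j, (η j = 1 ∧ X (j + 1) = X j + 1) ∨ (η j = 0 ∧ X (j + 1) = X j))
    (u : ℕ → ℝ) (n : ℕ) :
    ∑ j ∈ Finset.range n, u (X j) * η j = ∑ m ∈ Finset.range (X n), u m := by
  induction n with
  | zero => simp [h0]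
  | succ n ih =>
    rw [Finset.sum_range_succ, ih]
    rcases hX n with ⟨h1, h2⟩ | ⟨h1, h2⟩
    · rw [h1, h2, Finset.sum_range_succ, mul_one]
    · rw [h1, h2, mul_zero, add_zero]

theorem le_of_unit_steps {X : ℕ → ℕ} {η : ℕ → ℝ} (h0 : X 0 = 0)
    (hX : ∀ j, (η j = 1 ∧ X (j + 1) = X j + 1) ∨ (η j = 0 ∧ X (j + 1) = X j)) (n : ℕ) :
    X n ≤ n := by
  induction n with
  | zero => exact h0.le
  | succ n ih => rcases hX n with ⟨-, h⟩ | ⟨-, h⟩ <;> omega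

/-- The average number of visits of one coordinate to the tail set. -/
theorem exists_bound_avg_tailSet {G : Set ℕ} (hG : Summable (recipOn G)) (H : Finset ℤ) (z : ℕ)
    {X : ℕ → ℕ} {η : ℕ → ℝ} (h0 : X 0 = 0)
    (hX : ∀ j, (η j = 1 ∧ X (j + 1) = X j + 1) ∨ (η j = 0 ∧ X (j + 1) = X j))
    {β : ℝ} (hβ : 0 < β)
    (hbal : Tendsto (fun n : ℕ => (∑ j ∈ Finset.range n,
      (tailSet G H z).indicator (fun _ => (1 : ℝ)) (X j) * (η j - β)) / (n : ℝ)) atTop (𝓝 0)) :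
    ∃ b : ℕ → ℝ, Tendsto b atTop (𝓝 (2 * H.card * recipTail G z / β)) ∧ ∀ᶠ n : ℕ in atTop,
      (∑ j ∈ Finset.range n, (tailSet G H z).indicator (fun _ => (1 : ℝ)) (X j)) / (n : ℝ)
        ≤ b n := by
  set u := (tailSet G H z).indicator (fun _ => (1 : ℝ))
  have hu : ∀ m, 0 ≤ u m := fun m => Set.indicator_nonneg (fun _ _ => zero_le_one) m
  obtain ⟨K, hK⟩ : ∃ K : ℕ, ∀ h ∈ H, |h| ≤ K := by
    refine ⟨H.sup Int.natAbs, fun h hh => ?_⟩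
    rw [Int.abs_eq_natAbs]
    exact_mod_cast Finset.le_sup (f := Int.natAbs) hh
  set c : ℝ := H.card * (K * recipTail G z + 1) with hc
  have hconst : Tendsto (fun n : ℕ => c / (n : ℝ)) atTop (𝓝 0) :=
    tendsto_div_of_abs_le fun _ => le_refl |c|
  refine ⟨fun n => (2 * H.card * recipTail G z + c / n -
    (∑ j ∈ Finset.range n, u (X j) * (η j - β)) / (n : ℝ)) / β, ?_, ?_⟩
  · have := ((hconst.const_add (2 * H.card * recipTail G z)).sub hbal).div_const β
    simpa using this
  · filter_upwards [eventually_ge_atTop 1] with n hn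
    have hn' : (0 : ℝ) < n := by exact_mod_cast hn
    have h1 : ∑ j ∈ Finset.range n, u (X j) * η j ≤
        H.card * ((2 * n + K) * recipTail G z + 1) := by
      rw [sum_mul_step_eq h0 hX]
      refine le_trans ?_ (sum_indicator_tailSet_le hG hK z n)
      exact Finset.sum_le_sum_of_subset_of_nonneg
        (Finset.range_subset_range.2 (le_of_unit_steps h0 hX n)) fun m _ _ => hu m
    -- Replacing `η j` by its mean `β` costs only the balanced sum, so the unweighted visits are
    -- controlled by the weighted ones.
    have h2 : β * ∑ j ∈ Finset.range n, u (X j) = ∑ j ∈ Finset.range n, u (X j) * η j -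
        ∑ j ∈ Finset.range n, u (X j) * (η j - β) := by
      rw [Finset.mul_sum, ← Finset.sum_sub_distrib]
      exact Finset.sum_congr rfl fun j _ => by ring
    have h3 : 2 * H.card * recipTail G z + c / n -
        (∑ j ∈ Finset.range n, u (X j) * (η j - β)) / (n : ℝ) =
        (H.card * ((2 * n + K) * recipTail G z + 1) -
          ∑ j ∈ Finset.range n, u (X j) * (η j - β)) / (n : ℝ) := by
      rw [hc]; field_simp; ring
    rw [h3, le_div_iff₀ hβ, div_mul_eq_mul_div]
    gcongr
    rw [mul_comm, h2]
    linarith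

/-! ### Passage to the limit -/

theorem tendsto_of_approx {x : ℕ → ℝ} {a b : ℕ → ℕ → ℝ} {c d : ℕ → ℝ} {L : ℝ}
    (ha : ∀ z, Tendsto (a z) atTop (𝓝 (c z))) (hc : Tendsto c atTop (𝓝 L))
    (hb : ∀ z, Tendsto (b z) atTop (𝓝 (d z))) (hd : Tendsto d atTop (𝓝 0))
    (hx : ∀ z, ∀ᶠ n in atTop, |x n - a z n| ≤ b z n) : Tendsto x atTop (𝓝 L) := by
  rw [Metric.tendsto_nhds]
  intro ε hε
  obtain ⟨z, hz1, hz2⟩ := ((Metric.tendsto_nhds.1 hc (ε / 3) (by positivity)).and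
    (hd.eventually_lt_const (by positivity : 0 < ε / 3))).exists
  filter_upwards [hx z, Metric.tendsto_nhds.1 (ha z) (ε / 3 ) (by positivity),
    (hb z).eventually_lt_const hz2] with n h1 h2 h3
  rw [Real.dist_eq] at *
  have := abs_sub_le (x n) (a z n) L
  have := abs_sub_le (a z n) (c z) L
  linarith

/-- The full and the truncated sieve disagree at a point only if a modulus beyond `z` removes one of
its coordinates. -/
theorem abs_indicator_sub_le (G₁ G₂ : Set ℕ) (H₁ H₂ : Finset ℤ) (z : ℕ) (q : ℕ × ℕ) :
    |(sievedSet G₁ H₁ ×ˢ sievedSet G₂ H₂).indicator (fun _ => (1 : ℝ)) q -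
      (sievedSet (upTo G₁ z : Set ℕ) H₁ ×ˢ sievedSet (upTo G₂ z : Set ℕ) H₂).indicator
        (fun _ => (1 : ℝ)) q| ≤ (tailSet G₁ H₁ z).indicator (fun _ => (1 : ℝ)) q.1 +
          (tailSet G₂ H₂ z).indicator (fun _ => (1 : ℝ)) q.2 := by
  have hiff : ∀ (G : Set ℕ) (H : Finset ℤ) (m : ℕ), m ∉ tailSet G H z →
      (m ∈ sievedSet G H ↔ m ∈ sievedSet (upTo G z : Set ℕ) H) := fun G H m hm => by
    constructor
    · exact fun h a ha g hg => h a ha g (mem_upTo.1 hg).2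
    · intro h a ha g hg hmod
      rcases le_or_gt g z with hgz | hgz
      · exact h a ha g (mem_upTo.2 ⟨hgz, hg⟩) hmod
      · exact hm ⟨g, hg, hgz, a, ha, hmod⟩
  have hle : ∀ S T : Set (ℕ × ℕ), |S.indicator (fun _ => (1 : ℝ)) q -
      T.indicator (fun _ => (1 : ℝ)) q| ≤ 1 := fun S T => by
    classical
    rw [Set.indicator_apply, Set.indicator_apply]
    split_ifs <;> simp
  have hn : ∀ (S : Set ℕ) (m : ℕ), 0 ≤ S.indicator (fun _ => (1 : ℝ)) m := fun S m =>
    Set.indicator_nonneg (fun _ _ => zero_le_one) m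
  by_cases h1 : q.1 ∈ tailSet G₁ H₁ z
  · refine (hle _ _).trans ?_
    rw [Set.indicator_of_mem h1]
    linarith [hn (tailSet G₂ H₂ z) q.2]
  by_cases h2 : q.2 ∈ tailSet G₂ H₂ z
  · refine (hle _ _).trans ?_
    rw [Set.indicator_of_mem h2]
    linarith [hn (tailSet G₁ H₁ z) q.1]
  classical
  rw [Set.indicator_apply, Set.indicator_apply]
  simp only [Set.mem_prod, hiff _ _ _ h1, hiff _ _ _ h2, sub_self, abs_zero]
  exact add_nonneg (hn _ _) (hn _ _)

theorem visitProportion_eq (V : Set (ℕ × ℕ)) (p : ℕ → ℕ × ℕ) (n : ℕ) :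
    visitProportion V p n =
      (∑ j ∈ Finset.range n, V.indicator (fun _ => (1 : ℝ)) (p j)) / (n : ℝ) +
      (V.indicator (fun _ => (1 : ℝ)) (p n) - V.indicator (fun _ => (1 : ℝ)) (p 0)) / (n : ℝ) := by
  rw [visitProportion, ← add_div]
  congr 1
  have h1 : Finset.Icc 1 n = Finset.Ico 1 (n + 1) := by ext; simp
  have h2 := Finset.sum_range_succ (fun j => V.indicator (fun _ => (1 : ℝ)) (p j)) n
  have h3 := Finset.sum_range_succ' (fun j => V.indicator (fun _ => (1 : ℝ)) (p j)) n
  rw [h1, Finset.sum_Ico_eq_sum_range]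
  simp_rw [add_comm 1]
  simp only [Nat.add_sub_cancel]
  linarith

theorem theorem1p6
    (G₁ G₂ : Set ℕ) (H₁ H₂ : Finset ℤ)
    (hG₁ : G₁.Pairwise Nat.Coprime) (hG₂ : G₂.Pairwise Nat.Coprime)
    (hH₁ : Admissible G₁ H₁) (hH₂ : Admissible G₂ H₂)
    (θ₁ θ₂ : ℝ) (hθ₁ : θ₁ < 1) (hθ₂ : θ₂ < 1)
    (A₁ A₂ ε₁ ε₂ : ℝ) (hε₁ : 0 < ε₁) (hεA₁ : ε₁ < A₁) (hε₂ : 0 < ε₂) (hεA₂ : ε₂ < A₂)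
    (hA₁ : ConditionA θ₁ A₁ ε₁ (truncProductSet G₁ A₁))
    (hA₂ : ConditionA θ₂ A₂ ε₂ (truncProductSet G₂ A₂))
    (α : ℝ) (hα₀ : 0 < α) (hα₁ : α < 1)
    {Ω : Type*} [MeasurableSpace Ω] (μ : Measure Ω) [IsProbabilityMeasure μ]
    (P : ℕ → Ω → ℕ × ℕ) (hP : IsAlphaRandomWalk μ α P) :
    Multipliable (localFactor G₁ H₁) ∧ Multipliable (localFactor G₂ H₂) ∧
    ∀ᵐ ω ∂μ, Tendsto
      (fun n : ℕ => visitProportion (sievedSet G₁ H₁ ×ˢ sievedSet G₂ H₂) (fun i => P i ω) n)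
      atTop (𝓝 (sieveDensity G₁ H₁ * sieveDensity G₂ H₂)) := by
  have hS₁ := hA₁.summable_recipOn hθ₁ hε₁ hεA₁
  have hS₂ := hA₂.summable_recipOn hθ₂ hε₂ hεA₂
  have hM₁ := multipliable_localFactor hS₁ H₁
  have hM₂ := multipliable_localFactor hS₂ H₂
  refine ⟨hM₁, hM₂, ?_⟩
  have hsub : ∀ (G : Set ℕ) z, (upTo G z : Set ℕ) ⊆ G := fun G z g hg => (mem_upTo.1 hg).2
  have hne : ∀ (G : Set ℕ) (H : Finset ℤ), Admissible G H → ∀ z, ∀ g ∈ upTo G z, g ≠ 0 :=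
    fun G H hH z g hg => (Nat.zero_lt_of_lt (hH g (mem_upTo.1 hg).2)).ne'
  choose f hf hfz using fun z => tendsto_avg_sievedSet_finset (hG₁.mono (hsub G₁ z))
    (hG₂.mono (hsub G₂ z)) (hne G₁ H₁ hH₁ z) (hne G₂ H₂ hH₂ z) H₁ H₂ hα₀ hα₁
  choose C hC using hf
  obtain ⟨ξ, hpath, hbal⟩ := hP.exists_steps hα₀ hα₁
  have hind : ∀ (S : Set ℕ) (m : ℕ), |S.indicator (fun _ => (1 : ℝ)) m| ≤ 1 := fun S m => by
    classical
    rw [Set.indicator_apply]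
    split_ifs <;> simp
  -- The truncation level `z` is a natural number, so countably many null sets are discarded.
  have hE₀ := ae_all_iff.2 fun z => hbal (f z) (C z) (hC z)
  have hE₁ := ae_all_iff.2 fun z => hbal
    (fun q => (tailSet G₁ H₁ z).indicator (fun _ => (1 : ℝ)) q.1) 1 fun q => hind _ _
  have hE₂ := ae_all_iff.2 fun z => hbal
    (fun q => (tailSet G₂ H₂ z).indicator (fun _ => (1 : ℝ)) q.2) 1 fun q => hind _ _
  filter_upwards [hpath, hE₀, hE₁, hE₂] with ω hp h₀ h₁ h₂
  choose b₁ hb₁ hle₁ using fun z => exists_bound_avg_tailSet hS₁ H₁ z (X := fun j => (P j ω).1)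
    (η := fun j => ξ j ω) (by simp [hp.start]) (fun j => by
      rcases hp.step j with ⟨h, h'⟩ | ⟨h, h'⟩ <;> simp [h, h']) hα₀ (h₁ z)
  -- The second coordinate moves when `ξ j = 0`: its step indicator is `1 - ξ j`, its weight is `1 -
  -- α`, and the balanced sum changes sign.
  choose b₂ hb₂ hle₂ using fun z => exists_bound_avg_tailSet hS₂ H₂ z (X := fun j => (P j ω).2)
    (η := fun j => 1 - ξ j ω) (by simp [hp.start]) (fun j => by
      rcases hp.step j with ⟨h, h'⟩ | ⟨h, h'⟩ <;> simp [h, h']) (sub_pos.2 hα₁) (by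
      have := (h₂ z).neg
      rw [neg_zero] at this
      refine this.congr fun n => ?_
      rw [← neg_div, ← Finset.sum_neg_distrib]
      congr 1
      exact Finset.sum_congr rfl fun j _ => by ring)
  have hmain : Tendsto (fun n : ℕ => (∑ j ∈ Finset.range n,
      (sievedSet G₁ H₁ ×ˢ sievedSet G₂ H₂).indicator (fun _ => (1 : ℝ)) (P j ω)) / (n : ℝ))
      atTop (𝓝 (sieveDensity G₁ H₁ * sieveDensity G₂ H₂)) := by
    refine tendsto_of_approx (fun z => hfz z _ _ hp (h₀ z))
      ((tendsto_prod_upTo hM₁).mul (tendsto_prod_upTo hM₂))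
      (fun z => (hb₁ z).add (hb₂ z)) ?_ fun z => ?_
    · have := (((tendsto_recipTail G₁).const_mul (2 * H₁.card : ℝ)).div_const α).add
        (((tendsto_recipTail G₂).const_mul (2 * H₂.card : ℝ)).div_const (1 - α))
      simpa using this
    · filter_upwards [hle₁ z, hle₂ z] with n hn₁ hn₂
      refine le_trans ?_ (add_le_add hn₁ hn₂)
      rw [← sub_div, ← add_div, abs_div, Nat.abs_cast, ← Finset.sum_sub_distrib,
        ← Finset.sum_add_distrib]
      gcongr
      exact (Finset.abs_sum_le_sum_abs _ _).trans
        (Finset.sum_le_sum fun j _ => abs_indicator_sub_le G₁ G₂ H₁ H₂ z _)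
  have hbd : Tendsto (fun n : ℕ =>
      ((sievedSet G₁ H₁ ×ˢ sievedSet G₂ H₂).indicator (fun _ => (1 : ℝ)) (P n ω) -
        (sievedSet G₁ H₁ ×ˢ sievedSet G₂ H₂).indicator (fun _ => (1 : ℝ)) (P 0 ω)) / (n : ℝ))
      atTop (𝓝 0) :=
    tendsto_div_of_abs_le (C := 1) fun n => by
      classical
      rw [Set.indicator_apply, Set.indicator_apply]
      split_ifs <;> simp
  have := hmain.add hbd
  rw [add_zero] at this
  exact this.congr fun n => (visitProportion_eq _ _ n).symm
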